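/- An orientable map $\mathcal M=\mathcal M(D;r,\ell)$ consists of a finite set $D$ (the arcs), a fixed-point-free permutation $r$ of $D$ and a fixed-point-free involution $\ell$ of $D$ such that $\langle r,\ell\rangle$ is transitive on $D$. Its vertices are the orbits of $\langle r\rangle$ on $D$. Its automorphism group $G=\mathrm{Aut}(\mathcal M)$ (the orientation-preserving automorphisms) is the group of all permutations of $D$ commuting with $r$ and $\ell$. The map is orientably-regular if $G$ acts regularly on $D$. For a prime $p$, an orientably-regular map whose number of vertices is a power of $p$ is called normal if $G$ has a normal Sylow $p$-subgroup. **Proposition.** Let $p$ be a prime, $k\ge 2$, and let $\mathcal M$ be a normal orientably-regular map with $p^k$ vertices such that $G=\mathrm{Aut}(\mathcal M)$ acts primitively on the set of vertices. Let $H$ be the stabilizer in $G$ of a vertex, $H_G=\bigcap_{g\in G}gHg^{-1}$ its core, $P$ the Sylow $p$-subgroup of $G$, and $P_0=P\cap H_G$. Then one of the following holds: 1. $P=P_0\times T$ (internal direct product) for some subgroup $T\cong\mathbb Z_p^k$; 2. $P_0=Z(P)$, $k$ is even, and $P$ is the internal central product $P=E\ast P_0$ (that is, $P=EP_0$, $[E,P_0]=1$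 and $E\cap P_0$ is central in $P$) for some extra-special $p$-subgroup $E$ of $P$; if $p>2$, then $E$ can be taken to be $\Omega_1(P)=\langle x\in P : x^p=1\rangle$. Here a finite $p$-group $E$ is extra-special if $\Phi(E)=E'=Z(E)$ is of order $p$, where $\Phi(E)$ is the Frattini subgroup. -/

import Mathlib

/-- A combinatorial orientable map with arc set `D` (to be used with `D` finite): a fixed-point-free
permutation `r` (the local rotation) and a fixed-point-free involution `ℓ` (the arc-reversing
involution) of `D` such that `⟨r, ℓ⟩` is transitive on `D`. -/
structure OrientableMap (D : Type*) where
  r : Equiv.Perm D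
  ℓ : Equiv.Perm D
  r_ne : ∀ d, r d ≠ d
  ℓ_ne : ∀ d, ℓ d ≠ d
  ℓ_invol : ∀ d, ℓ (ℓ d) = d
  transitive : MulAction.IsPretransitive (Subgroup.closure {r, ℓ} : Subgroup (Equiv.Perm D)) D

namespace OrientableMap

variable {D : Type*} (M : OrientableMap D)

/-- The group of (orientation-preserving) automorphisms: the permutations of the arcs that
commute with `r` and with `ℓ`. -/
def aut : Subgroup (Equiv.Perm D) := Subgroup.centralizer {M.r, M.ℓ}

/-- The map is orientably-regular: its automorphism group acts regularly on the arcs. -/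
def IsOrientablyRegular : Prop := ∀ x y : D, ∃! g : M.aut, g • x = y

/-- The vertices are the orbits of `⟨r⟩` on the arcs. -/
def Vertex : Type _ := MulAction.orbitRel.Quotient (Subgroup.zpowers M.r) D

/-- The vertex an arc belongs to, i.e. its `⟨r⟩`-orbit. -/
def vertexOf (d : D) : M.Vertex :=
  Quotient.mk (MulAction.orbitRel (Subgroup.zpowers M.r) D) d

theorem aut_commute_zpow (g : M.aut) (n : ℤ) (d : D) :
    (g : Equiv.Perm D) ((M.r ^ n) d) = (M.r ^ n) ((g : Equiv.Perm D) d) := by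
  have h : Commute (g : Equiv.Perm D) M.r := (g.2 M.r (by simp)).symm
  exact congrArg (fun f : Equiv.Perm D => f d) (h.zpow_right n)

/-- The induced action on the vertices: `g` sends the vertex of the arc `d` to that of `g d`. -/
instance : MulAction M.aut M.Vertex where
  smul g := Quotient.map (fun d => (g : Equiv.Perm D) d) (by
    rintro a b ⟨⟨_, n, rfl⟩, h⟩
    refine ⟨⟨M.r ^ n, n, rfl⟩, ?_⟩
    rw [← h]
    exact (M.aut_commute_zpow g n b).symm)
  one_smul := by rintro ⟨d⟩; rfl
  mul_smul := by rintro g h ⟨d⟩; rfl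

/-- The map is normal with respect to `p`: its automorphism group has a normal Sylow
`p`-subgroup. -/
def IsNormalMap (p : ℕ) : Prop := ∃ P : Sylow p M.aut, (P : Subgroup M.aut).Normal

end OrientableMap

/-- Extra-special `p`-groups: finite `p`-groups `E` with `Φ(E) = E' = Z(E)` of order `p`. -/
def IsExtraspecial (p : ℕ) (E : Type*) [Group E] : Prop :=
  Finite E ∧ IsPGroup p E ∧ frattini E = Subgroup.center E ∧ commutator E = Subgroup.center E ∧
    Nat.card (Subgroup.center E) = p

/-- The center `Z(P)` of a subgroup `P` of `G`, as a subgroup of `G`. -/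
def centerIn {G : Type*} [Group G] (P : Subgroup G) : Subgroup G :=
  (Subgroup.center P).map P.subtype

/-- `P` is the internal direct product `A × B`. -/
def IsInternalDirectProduct {G : Type*} [Group G] (P A B : Subgroup G) : Prop :=
  A ⊔ B = P ∧ A ⊓ B = ⊥ ∧ ⁅A, B⁆ = ⊥

/-- `P` is the (internal) central product `A ∗ B`, related to the central subgroup `A ⊓ B`. -/
def IsCentralProduct {G : Type*} [Group G] (P A B : Subgroup G) : Prop :=
  A ⊔ B = P ∧ A ⊓ B ≤ centerIn P ∧ ⁅A, B⁆ = ⊥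

/-- `Ω₁(P) = ⟨x ∈ P | x ^ p = 1⟩`. -/
def omegaOne {G : Type*} [Group G] (p : ℕ) (P : Subgroup G) : Subgroup G :=
  Subgroup.closure {x | x ∈ P ∧ x ^ p = 1}

open scoped commutatorElement

/-! By regularity a vertex stabilizer `H` is cyclic, generated by some `R`; by primitivity it is
maximal, of index `p ^ k`. Hence `G = PH`, and since normalizers grow in the nilpotent group `P`,
maximality makes `P ∩ H` normal in `G`. So `P₀ = P ∩ H`, and `R` acts irreducibly on `P / P₀`, of
order `p ^ k`. `IsIrreducibleSection` records this situation; the rest is group theory.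

Irreducibility makes `P / P₀` elementary abelian, and `k ≥ 2` rules out nontrivial fixed points of
`R` on it. It follows that `P₀` is central in `G`. On the abelian group `P / P'` the endomorphism `x
↦ [R, x]` has kernel `P₀ / P'`, which meets its image trivially, so the image is a complement. Its
preimage `E` satisfies `E P₀ = P` and `E ∩ P₀ = P'` (`exists_supplement`).

If `P' = 1`, then `E` is the direct factor `T`. Otherwise `P'` is the subgroup of order `p` of the
cyclic group `P₀`, and `P₀ = Z(P)`. The commutator is then a nondegenerate alternating form on `P /
Z(P)`, so `k` is even, and `E` is extra-special. For odd `p`, the elements `[R, y] c` of `E`, with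
`c ∈ P'`, have trivial `p`-th power, which gives `E = Ω₁(P)`. -/

/-! ### Alternating forms and commutators in groups of class two. -/

/-- A maximal totally isotropic subspace `W` equals its orthogonal, so the dimension is twice that
of `W`. -/
theorem LinearMap.BilinForm.IsAlt.even_finrank {K V : Type*} [Field K] [AddCommGroup V] [Module K V]
    [FiniteDimensional K V] {B : LinearMap.BilinForm K V} (hB : B.IsAlt) (hnd : B.Nondegenerate) :
    Even (Module.finrank K V) := by
  obtain ⟨W, hW⟩ := exists_maximal_of_wellFoundedGT (fun W : Submodule K V => W ≤ B.orthogonal W)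
    ⟨⊥, bot_le⟩
  have key : B.orthogonal W ≤ W := by
    intro x hx
    have hWx : W ⊔ K ∙ x ≤ B.orthogonal (W ⊔ K ∙ x) := by
      intro y hy z hz
      obtain ⟨w, hw, a, ha, rfl⟩ := Submodule.mem_sup.1 hy
      obtain ⟨w', hw', a', ha', rfl⟩ := Submodule.mem_sup.1 hz
      obtain ⟨c, rfl⟩ := Submodule.mem_span_singleton.1 ha
      obtain ⟨c', rfl⟩ := Submodule.mem_span_singleton.1 ha'
      have h1 : B w' w = 0 := hW.prop hw w' hw'
      have h2 : B w' x = 0 := hx w' hw'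
      have h3 : B x w = 0 := hB.isRefl _ _ (hx w hw)
      have h4 : B x x = 0 := hB x
      simp [h1, h2, h3, h4]
    exact hW.le_of_ge hWx le_sup_left
      (Submodule.mem_sup_right (Submodule.mem_span_singleton_self x))
  have heq : B.orthogonal W = W := le_antisymm key hW.prop
  have h := LinearMap.BilinForm.finrank_add_finrank_orthogonal' (B := B) W
  rw [hnd.ker_eq_bot, inf_bot_eq, finrank_bot, add_zero, heq] at h
  exact ⟨_, h.symm⟩

theorem commutatorElement_mul_left_of_central {P : Type*} [Group P]
    (hle : ∀ x y : P, ⁅x, y⁆ ∈ Subgroup.center P) (x y z : P) : ⁅x * y, z⁆ = ⁅x, z⁆ * ⁅y, z⁆ := by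
  have h := Subgroup.mem_center_iff.1 (hle y z)
  calc ⁅x * y, z⁆ = x * ⁅y, z⁆ * x⁻¹ * ⁅x, z⁆ := by simp only [commutatorElement_def]; group
    _ = ⁅y, z⁆ * ⁅x, z⁆ := by rw [h x]; group
    _ = _ := (h _).symm

theorem commutatorElement_mul_right_of_central {P : Type*} [Group P]
    (hle : ∀ x y : P, ⁅x, y⁆ ∈ Subgroup.center P) (x y z : P) : ⁅x, y * z⁆ = ⁅x, y⁆ * ⁅x, z⁆ := by
  rw [← commutatorElement_inv, commutatorElement_mul_left_of_central hle, mul_inv_rev,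
    commutatorElement_inv, commutatorElement_inv]
  exact (Subgroup.mem_center_iff.1 (hle x y) _)

theorem commutatorElement_pow_left_of_central {P : Type*} [Group P]
    (hle : ∀ x y : P, ⁅x, y⁆ ∈ Subgroup.center P) (x y : P) (n : ℕ) : ⁅x ^ n, y⁆ = ⁅x, y⁆ ^ n := by
  induction n with
  | zero => simp
  | succ n ih => rw [pow_succ, commutatorElement_mul_left_of_central hle, ih, pow_succ]

theorem even_of_alternating_nondegenerate {V : Type*} [AddCommGroup V] [Finite V] {p k : ℕ}
    [Fact p.Prime] (hp : ∀ v : V, p • v = 0) (b : V → V → ZMod p)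
    (hl : ∀ u v w, b (u + v) w = b u w + b v w) (hr : ∀ u v w, b u (v + w) = b u v + b u w)
    (halt : ∀ v, b v v = 0) (hnd : ∀ u, (∀ v, b u v = 0) → u = 0) (hk : Nat.card V = p ^ k) :
    Even k := by
  let : Module (ZMod p) V := AddCommGroup.zmodModule (n := p) (G := V) hp
  let B : LinearMap.BilinForm (ZMod p) V := LinearMap.mk₂ (ZMod p) b hl
    (fun a u v => ZMod.map_smul (AddMonoidHom.mk' (fun u => b u v) fun u w => hl u w v) a u)
    hr (fun a u v => ZMod.map_smul (AddMonoidHom.mk' (b u) (hr u)) a v)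
  have hBalt : B.IsAlt := halt
  have hBnd : B.Nondegenerate :=
    (LinearMap.IsRefl.nondegenerate_iff_separatingLeft hBalt.isRefl).2 hnd
  have : Module.Finite (ZMod p) V := Module.Finite.of_finite
  have hfin : Even (Module.finrank (ZMod p) V) :=
    LinearMap.BilinForm.IsAlt.even_finrank hBalt hBnd
  have hcard : Nat.card V = p ^ Module.finrank (ZMod p) V := by
    rw [Module.natCard_eq_pow_finrank (K := ZMod p), Nat.card_zmod]
  rwa [Nat.pow_right_injective (Fact.out : p.Prime).two_le (hk.symm.trans hcard)]

/-- With `P'` identified with `ZMod p`, the commutator descends to an alternating form on `P /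
Z(P)`; it is nondegenerate because its radical in `P` is the center. -/
theorem even_of_card_quotient_center {P : Type*} [Group P] [Finite P] {p k : ℕ} [Fact p.Prime]
    (hc : Nat.card (commutator P) = p) (hle : commutator P ≤ Subgroup.center P)
    (hpow : ∀ x : P, x ^ p ∈ Subgroup.center P) (hk : Nat.card (P ⧸ Subgroup.center P) = p ^ k) :
    Even k := by
  have hcm : ∀ x y : P, ⁅x, y⁆ ∈ commutator P := fun x y =>
    Subgroup.commutator_mem_commutator (Subgroup.mem_top x) (Subgroup.mem_top y)
  have hcz : ∀ x y : P, ⁅x, y⁆ ∈ Subgroup.center P := fun x y => hle (hcm x y)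
  let : CommGroup (P ⧸ Subgroup.center P) :=
    { (inferInstance : Group (P ⧸ Subgroup.center P)) with
      mul_comm := by
        rintro ⟨x⟩ ⟨y⟩
        refine QuotientGroup.eq.2 ?_
        have := hcz y⁻¹ x⁻¹
        rwa [commutatorElement_def, inv_inv, inv_inv, mul_assoc (y⁻¹ * x⁻¹), ← mul_inv_rev] at this }
  let e : commutator P ≃* Multiplicative (ZMod p) :=
    mulEquivOfPrimeCardEq hc (by simp)
  let c : P → P → ZMod p := fun x y => (e ⟨⁅x, y⁆, hcm x y⟩).toAdd
  have c_mul_left : ∀ x y z, c (x * y) z = c x z + c y z := fun x y z => by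
    simp only [c]
    rw [← toAdd_mul, ← map_mul]
    congr 2
    exact Subtype.ext (commutatorElement_mul_left_of_central hcz x y z)
  have c_mul_right : ∀ x y z, c x (y * z) = c x y + c x z := fun x y z => by
    simp only [c]
    rw [← toAdd_mul, ← map_mul]
    congr 2
    exact Subtype.ext (commutatorElement_mul_right_of_central hcz x y z)
  have c_eq_zero : ∀ x y, c x y = 0 ↔ ⁅x, y⁆ = 1 := fun x y => by
    simp only [c]
    rw [toAdd_eq_zero, map_eq_one_iff e e.injective, Subgroup.mk_eq_one]
  have c_central_left : ∀ x ∈ Subgroup.center P, ∀ y, c x y = 0 := fun x hx y =>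
    (c_eq_zero x y).2 (commutatorElement_eq_one_iff_mul_comm.2 (Subgroup.mem_center_iff.1 hx y).symm)
  have c_central_right : ∀ x, ∀ y ∈ Subgroup.center P, c x y = 0 := fun x y hy =>
    (c_eq_zero x y).2 (commutatorElement_eq_one_iff_mul_comm.2 (Subgroup.mem_center_iff.1 hy x))
  let b : (Additive (P ⧸ Subgroup.center P)) → (Additive (P ⧸ Subgroup.center P)) → ZMod p := fun u v => Quotient.liftOn₂' u.toMul v.toMul c (by
    intro x y x' y' h h'
    rw [QuotientGroup.leftRel_apply] at h h'
    have h1 := c_central_left _ h y'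
    have h2 := c_central_right x _ h'
    calc c x y = c x (y * (y⁻¹ * y')) := by rw [c_mul_right, h2, add_zero]
      _ = c (x * (x⁻¹ * x')) y' := by rw [c_mul_left, h1, add_zero]; congr 1; group
      _ = c x' y' := by congr 1; group)
  have b_add_left : ∀ u v w, b (u + v) w = b u w + b v w := by
    rintro ⟨x⟩ ⟨y⟩ ⟨z⟩
    exact c_mul_left x y z
  have b_add_right : ∀ u v w, b u (v + w) = b u v + b u w := by
    rintro ⟨x⟩ ⟨y⟩ ⟨z⟩
    exact c_mul_right x y z
  refine even_of_alternating_nondegenerate (V := Additive (P ⧸ Subgroup.center P)) (p := p) ?_ b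
    b_add_left b_add_right ?_ ?_ hk
  · rintro ⟨x⟩
    exact (QuotientGroup.eq_one_iff (x ^ p)).2 (hpow x)
  · rintro ⟨x⟩
    exact (c_eq_zero x x).2 (commutatorElement_self x)
  · rintro ⟨x⟩ hx
    refine (QuotientGroup.eq_one_iff x).2 (Subgroup.mem_center_iff.2 fun y => ?_)
    exact (commutatorElement_eq_one_iff_mul_comm.1 ((c_eq_zero x y).1
      (hx (Additive.ofMul (QuotientGroup.mk y))))).symm

/-! ### Elementary abelian groups, powers of products, complements. -/

/-- Subgroups are `ZMod p`-subspaces, so the Frattini subgroup has a complement; being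
nongenerating, it is trivial. -/
theorem frattini_eq_bot_of_pow_eq_one {A : Type*} [CommGroup A] [Finite A] {p : ℕ} [Fact p.Prime]
    (hA : ∀ x : A, x ^ p = 1) : frattini A = ⊥ := by
  let : Module (ZMod p) (Additive A) := AddCommGroup.zmodModule (n := p) hA
  let e : Subgroup A ≃o Submodule (ZMod p) (Additive A) :=
    Subgroup.toAddSubgroup.trans (AddSubgroup.toZModSubmodule p)
  have : ComplementedLattice (Subgroup A) := e.complementedLattice_iff.2 inferInstance
  obtain ⟨K, hK⟩ := exists_isCompl (frattini A)
  have hK' : K = ⊤ := frattini_nongenerating (by rw [sup_comm]; exact hK.sup_eq_top)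
  rw [← hK.inf_eq_bot, hK', inf_top_eq]

theorem nonempty_mulEquiv_of_pow_eq_one {A : Type*} [CommGroup A] [Finite A] {p k : ℕ}
    [Fact p.Prime] (hA : ∀ x : A, x ^ p = 1) (hk : Nat.card A = p ^ k) :
    Nonempty (A ≃* Multiplicative (Fin k → ZMod p)) := by
  let : Module (ZMod p) (Additive A) := AddCommGroup.zmodModule (n := p) hA
  have : Finite (Additive A) := ‹Finite A›
  have hcard : Nat.card (Additive A) = p ^ Module.finrank (ZMod p) (Additive A) := by
    rw [Module.natCard_eq_pow_finrank (K := ZMod p), Nat.card_zmod]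
  have h : k = Module.finrank (ZMod p) (Additive A) :=
    Nat.pow_right_injective (Fact.out : p.Prime).two_le (hk.symm.trans hcard)
  obtain ⟨e⟩ := FiniteDimensional.nonempty_linearEquiv_of_finrank_eq
    (R := ZMod p) (M := Additive A) (M' := Fin k → ZMod p) (by simp [← h])
  exact ⟨AddEquiv.toMultiplicativeRight e.toAddEquiv⟩

/-- Collecting the factors `a` on the left takes `n.choose 2` swaps, each costing one central factor
`⁅b, a⁆`. -/
theorem mul_pow_of_central {G : Type*} [Group G] {a b : G} (h : ⁅b, a⁆ ∈ Subgroup.center G) (n : ℕ) :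
    (a * b) ^ n = a ^ n * b ^ n * ⁅b, a⁆ ^ (n * (n - 1) / 2) := by
  have hz : ∀ g : G, ∀ m : ℕ, Commute g (⁅b, a⁆ ^ m) := fun g m =>
    Commute.pow_right (Subgroup.mem_center_iff.1 h g) m
  have hba : ∀ m : ℕ, b ^ m * a = a * b ^ m * ⁅b, a⁆ ^ m := fun m => by
    induction m with
    | zero => simp
    | succ m ih =>
      have : b * a = a * b * ⁅b, a⁆ := by
        rw [← (Subgroup.mem_center_iff.1 h (a * b)).symm]; simp only [commutatorElement_def]; group
      calc b ^ (m + 1) * a = b ^ m * (b * a) := by rw [pow_succ, mul_assoc]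
        _ = b ^ m * a * b * ⁅b, a⁆ := by rw [this]; group
        _ = a * b ^ m * (⁅b, a⁆ ^ m * b) * ⁅b, a⁆ := by rw [ih]; group
        _ = _ := by rw [← (hz b m).eq, pow_succ, pow_succ]; group
  induction n with
  | zero => simp
  | succ n ih =>
    have hn : (n + 1) * (n + 1 - 1) / 2 = n + n * (n - 1) / 2 := by
      rw [← Nat.choose_two_right, ← Nat.choose_two_right, Nat.choose_succ_succ' n 1,
        Nat.choose_one_right]
    calc (a * b) ^ (n + 1) = a ^ n * b ^ n * (⁅b, a⁆ ^ (n * (n - 1) / 2) * (a * b)) := by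
          rw [pow_succ, ih]; group
      _ = a ^ n * (b ^ n * a) * b * ⁅b, a⁆ ^ (n * (n - 1) / 2) := by
          rw [← (hz _ _).eq]; simp only [mul_assoc]
      _ = a ^ (n + 1) * b ^ n * (⁅b, a⁆ ^ n * b) * ⁅b, a⁆ ^ (n * (n - 1) / 2) := by
          rw [hba, pow_succ]; simp only [mul_assoc]
      _ = _ := by
          rw [← (hz b n).eq, hn, pow_add _ n (n * (n - 1) / 2), pow_succ b]
          simp only [mul_assoc]

/-- The endomorphism `x ↦ ⁅R, x⁆` of `A` has kernel `A₀`. If `⁅R, y⁆ ∈ A₀` then `y ∈ A₀`, so `⁅R, y⁆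
= 1`: kernel and image are disjoint, and by counting they are complements. -/
theorem exists_complement_commutators {G : Type*} [Group G] [Finite G] {A A₀ : Subgroup G}
    [A.Normal] (hA : ∀ x ∈ A, ∀ y ∈ A, x * y = y * x) (hle : A₀ ≤ A)
    (hcen : A₀ ≤ Subgroup.center G) (R : G) (h : ∀ x ∈ A, ⁅R, x⁆ ∈ A₀ → x ∈ A₀) :
    ∃ T : Subgroup G, A₀ ⊔ T = A ∧ A₀ ⊓ T = ⊥ ∧ ∀ t ∈ T, ∃ x ∈ A, t = ⁅R, x⁆ := by
  have hmem : ∀ x ∈ A, ⁅R, x⁆ ∈ A := fun x hx =>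
    A.mul_mem (Subgroup.Normal.conj_mem inferInstance x hx R) (A.inv_mem hx)
  let φ : A →* A := MonoidHom.mk' (fun x => ⟨⁅R, (x : G)⁆, hmem x x.2⟩) fun x y => Subtype.ext (by
    have hc := hA _ (hmem y y.2) _ (A.inv_mem x.2)
    calc ⁅R, (x : G) * y⁆ = R * x * R⁻¹ * (⁅R, (y : G)⁆ * (x : G)⁻¹) := by
          simp only [commutatorElement_def]; group
      _ = ⁅R, (x : G)⁆ * ⁅R, (y : G)⁆ := by rw [hc]; simp only [commutatorElement_def]; group)
  have hzero : ∀ x ∈ A₀, ⁅R, x⁆ = 1 := fun x hx =>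
    commutatorElement_eq_one_iff_mul_comm.2 (Subgroup.mem_center_iff.1 (hcen hx) R)
  have hker : φ.ker = A₀.subgroupOf A := by
    ext x
    rw [MonoidHom.mem_ker, Subgroup.mem_subgroupOf]
    refine ⟨fun hx => h x x.2 ?_, fun hx => Subtype.ext (hzero x hx)⟩
    rw [show ⁅R, (x : G)⁆ = 1 from congrArg Subtype.val hx]
    exact A₀.one_mem
  have hdisj : Disjoint (A₀.subgroupOf A) φ.range := by
    rw [Subgroup.disjoint_def]
    rintro _ hx ⟨y, rfl⟩
    have hy : y ∈ φ.ker := hker ▸ h y y.2 hx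
    exact hy
  have hcompl := Subgroup.isComplement'_of_card_mul_and_disjoint
    (by rw [← hker, ← Subgroup.index_ker, Subgroup.card_mul_index]) hdisj
  have hmap : (A₀.subgroupOf A).map A.subtype = A₀ := by
    rw [Subgroup.subgroupOf_map_subtype, inf_eq_left.2 hle]
  refine ⟨φ.range.map A.subtype, ?_, ?_, ?_⟩
  · rw [← hmap, ← Subgroup.map_sup, hcompl.sup_eq_top, ← MonoidHom.range_eq_map,
      Subgroup.range_subtype]
  · rw [← hmap, ← Subgroup.map_inf _ _ _ A.subtype_injective, hdisj.eq_bot, Subgroup.map_bot]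
  · rintro _ ⟨_, ⟨x, rfl⟩, rfl⟩
    exact ⟨x, x.2, rfl⟩

/-! ### A criterion for extra-special groups. -/

theorem isExtraspecial_of_commutator_le_center {p : ℕ} [Fact p.Prime] {E : Type*} [Group E]
    [Finite E] (hE : IsPGroup p E) (hZ : Nat.card (Subgroup.center E) = p)
    (hle : commutator E ≤ Subgroup.center E) (hne : commutator E ≠ ⊥)
    (hpow : ∀ x : E, x ^ p ∈ Subgroup.center E) : IsExtraspecial p E := by
  have hcomm : commutator E = Subgroup.center E := by
    refine Subgroup.eq_of_le_of_card_ge hle ?_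
    have hdvd : Nat.card (commutator E) ∣ p := hZ ▸ Subgroup.card_dvd_of_le hle
    rcases (Nat.dvd_prime Fact.out).1 hdvd with h | h
    · exact absurd (Subgroup.card_eq_one.1 h) hne
    · rw [hZ, h]
  refine ⟨‹_›, hE, le_antisymm ?_ ?_, hcomm, hZ⟩
  · have := Subgroup.Normal.quotient_commutative_iff_commutator_le.2 hle
    let : CommGroup (E ⧸ Subgroup.center E) :=
      { (inferInstance : Group (E ⧸ Subgroup.center E)) with mul_comm := mul_comm' }
    have hfr : frattini (E ⧸ Subgroup.center E) = ⊥ := by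
      refine frattini_eq_bot_of_pow_eq_one (p := p) ?_
      rintro ⟨x⟩
      exact (QuotientGroup.eq_one_iff (x ^ p)).2 (hpow x)
    refine (frattini_le_comap_frattini_of_surjective
      (QuotientGroup.mk'_surjective (Subgroup.center E))).trans ?_
    rw [hfr, MonoidHom.comap_bot, QuotientGroup.ker_mk']
  -- A maximal subgroup `M` not containing `Z(E)` has `M Z(E) = E`, so `E' = M' ≤ M`, although `E' =
  -- Z(E)`.
  · refine le_iInf₂ fun M hM => ?_
    by_contra hnot
    have htop : M ⊔ Subgroup.center E = ⊤ :=
      hM.2 _ (lt_of_le_of_ne le_sup_left fun h => hnot (h ▸ le_sup_right))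
    refine hnot (hcomm ▸ ?_)
    rw [commutator_def, Subgroup.commutator_le]
    intro x _ y _
    obtain ⟨a, ha, z, hz, rfl⟩ := Subgroup.mem_sup_of_normal_right.1 (htop ▸ Subgroup.mem_top x)
    obtain ⟨b, hb, w, hw, rfl⟩ := Subgroup.mem_sup_of_normal_right.1 (htop ▸ Subgroup.mem_top y)
    have hcz : ∀ x y : E, ⁅x, y⁆ ∈ Subgroup.center E := fun x y =>
      hle (Subgroup.commutator_mem_commutator (Subgroup.mem_top x) (Subgroup.mem_top y))
    have h1 : ∀ y : E, ⁅z, y⁆ = 1 := fun y =>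
      commutatorElement_eq_one_iff_mul_comm.2 (Subgroup.mem_center_iff.1 hz y).symm
    have h2 : ⁅a, w⁆ = 1 :=
      commutatorElement_eq_one_iff_mul_comm.2 (Subgroup.mem_center_iff.1 hw a)
    rw [commutatorElement_mul_left_of_central hcz, h1, mul_one,
      commutatorElement_mul_right_of_central hcz, h2, mul_one]
    exact M.mul_mem (M.mul_mem (M.mul_mem ha hb) (M.inv_mem ha)) (M.inv_mem hb)

/-! ### Reduction to an irreducible action of a cyclic group. -/

/-- A normal `p`-subgroup `P` of `G = P⟨R⟩` together with a normal subgroup `P₀` of `P` contained in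
`⟨R⟩` such that `⟨R⟩` acts irreducibly on `P / P₀`, a group of order `p ^ k` with `2 ≤ k`. -/
structure IsIrreducibleSection {G : Type*} [Group G] (p k : ℕ) (P P₀ : Subgroup G) (R : G) :
    Prop where
  isPGroup : IsPGroup p P
  normal : P.Normal
  normal_bot : P₀.Normal
  le : P₀ ≤ P
  le_zpowers : P₀ ≤ Subgroup.zpowers R
  sup_eq_top : P ⊔ Subgroup.zpowers R = ⊤
  relIndex : P₀.relIndex P = p ^ k
  two_le : 2 ≤ k
  irreducible : ∀ N : Subgroup G, P₀ ≤ N → N ≤ P → (∀ x ∈ N, R * x * R⁻¹ ∈ N) → N = P₀ ∨ N = P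

theorem isIrreducibleSection_of_isCoatom {G : Type*} [Group G] [Finite G] {p k : ℕ} [Fact p.Prime]
    {H : Subgroup G} {R : G} (hR : H = Subgroup.zpowers R) (hH : IsCoatom H)
    (hidx : H.index = p ^ k) (hk : 2 ≤ k) (P : Sylow p G) [hP : (P : Subgroup G).Normal] :
    IsIrreducibleSection p k (P : Subgroup G) (H.normalCore ⊓ P) R := by
  have hPH : ¬ (P : Subgroup G) ≤ H := fun h => P.not_dvd_index
    ((dvd_pow_self p (by omega)).trans (hidx ▸ Subgroup.index_dvd_of_le h))
  have hsup : ∀ K : Subgroup G, ¬ K ≤ H → K ⊔ H = ⊤ := fun K hK =>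
    hH.2 _ (lt_of_le_of_ne le_sup_right fun h => hK (h.symm ▸ le_sup_left))
  have hPc : ∀ h y : G, y ∈ (P : Subgroup G) ↔ h * y * h⁻¹ ∈ (P : Subgroup G) := fun h y =>
    ⟨fun hy => hP.conj_mem y hy h, fun hy => by simpa [mul_assoc] using hP.conj_mem _ hy h⁻¹⟩
  have hnorm : (H ⊓ P : Subgroup G).Normal := by
    -- The normalizer of `H ∩ P` contains `H` and, since normalizers grow in `P`, an element of `P`
    -- outside `H`. By maximality of `H` it is all of `G`.
    have hnil : Group.IsNilpotent (P : Subgroup G) := P.isPGroup'.isNilpotent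
    have hlt := Group.normalizerCondition_of_isNilpotent (G := (P : Subgroup G))
      (H.subgroupOf P) (lt_top_iff_ne_top.2 fun h => hPH (Subgroup.subgroupOf_eq_top.1 h))
    obtain ⟨x, hx, hxH⟩ := SetLike.exists_of_lt hlt
    rw [← Subgroup.normalizer_eq_top_iff]
    refine hH.2 _ (lt_of_le_of_ne ?_ ?_)
    · intro h hh
      rw [Subgroup.mem_normalizer_iff]
      intro y
      have h1 : y ∈ H ↔ h * y * h⁻¹ ∈ H := by
        rw [Subgroup.mul_mem_cancel_right _ (H.inv_mem hh), Subgroup.mul_mem_cancel_left _ hh]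
      exact and_congr h1 (hPc h y)
    · intro h
      have hxn : (x : G) ∈ Subgroup.normalizer ((H ⊓ P : Subgroup G) : Set G) := by
        rw [Subgroup.mem_normalizer_iff] at hx ⊢
        intro y
        constructor
        · rintro ⟨hy, hyP⟩
          exact ⟨(hx ⟨y, hyP⟩).1 hy, hP.conj_mem y hyP x⟩
        · rintro ⟨hy, hyP⟩
          have hyP' : y ∈ (P : Subgroup G) := (hPc x y).2 hyP
          exact ⟨(hx ⟨y, hyP'⟩).2 hy, hyP'⟩
      exact hxH (Subgroup.mem_subgroupOf.2 (h.symm ▸ hxn))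
  have hcore : H.normalCore ⊓ P = H ⊓ P :=
    le_antisymm (inf_le_inf_right _ H.normalCore_le)
      (le_inf ((Subgroup.normal_le_normalCore).2 inf_le_left) inf_le_right)
  rw [hcore]
  refine ⟨P.isPGroup', hP, hnorm, inf_le_right, hR ▸ inf_le_left, hR ▸ hsup _ hPH, ?_, hk, ?_⟩
  · have h1 := Subgroup.relIndex_mul_index (inf_le_left : H ⊓ P ≤ H)
    rw [← Subgroup.relIndex_mul_index (inf_le_right : H ⊓ P ≤ P), Subgroup.inf_relIndex_left,
      ← Subgroup.relIndex_sup_left, hsup _ hPH, Subgroup.relIndex_top_right, mul_comm, hidx] at h1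
    exact (Nat.eq_of_mul_eq_mul_right (Nat.pos_of_ne_zero Subgroup.index_ne_zero_of_finite) h1).symm
  · intro N hN hNP hinv
    by_cases hNH : N ≤ H
    · exact Or.inl (le_antisymm (le_inf hNH hNP) hN)
    · right
      refine le_antisymm hNP fun x hx => ?_
      have hHN : H ≤ Subgroup.normalizer (N : Set G) := by
        rw [hR, Subgroup.zpowers_le]
        exact Subgroup.mem_normalizer_fintype hinv
      have hxt : x ∈ N ⊔ H := hsup N hNH ▸ Subgroup.mem_top x
      -- Dedekind's law: writing `x = h * n`, the factor `h` lies in `H ∩ P ≤ N`.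
      rw [← SetLike.mem_coe, sup_comm, Subgroup.coe_mul_of_left_le_normalizer_right _ _ hHN] at hxt
      obtain ⟨h, hh, n, hn, rfl⟩ := hxt
      exact N.mul_mem (hN ⟨hh, (Subgroup.mul_mem_cancel_right _ (hNP hn)).1 hx⟩) hn

/-! ### Consequences of irreducibility. -/

namespace IsIrreducibleSection

variable {G : Type*} [Group G] {p k : ℕ} {P P₀ : Subgroup G} {R : G}

theorem commutatorElement_mem (h : IsIrreducibleSection p k P P₀ R) (g : G) {x : G} (hx : x ∈ P) :
    ⁅g, x⁆ ∈ P :=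
  P.mul_mem (h.normal.conj_mem x hx g) (P.inv_mem hx)

theorem commutatorElement_mem_bot (h : IsIrreducibleSection p k P P₀ R) (g : G) {x : G}
    (hx : x ∈ P₀) : ⁅g, x⁆ ∈ P₀ :=
  P₀.mul_mem (h.normal_bot.conj_mem x hx g) (P₀.inv_mem hx)

theorem ne [Fact p.Prime] (h : IsIrreducibleSection p k P P₀ R) : P₀ ≠ P := by
  intro he
  have := h.relIndex
  rw [he, Subgroup.relIndex_self] at this
  exact absurd this (Nat.one_lt_pow (by have := h.two_le; omega) (Fact.out : p.Prime).one_lt).ne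

theorem eq_or_eq_of_normal (h : IsIrreducibleSection p k P P₀ R) {N : Subgroup G} (hN : N.Normal)
    (h₀ : P₀ ≤ N) (hP : N ≤ P) : N = P₀ ∨ N = P :=
  h.irreducible N h₀ hP fun x hx => hN.conj_mem x hx R

theorem card_map_mk [P₀.Normal] (h : IsIrreducibleSection p k P P₀ R) :
    Nat.card (P.map (QuotientGroup.mk' P₀)) = p ^ k := by
  rw [← Subgroup.relIndex_ker, QuotientGroup.ker_mk', h.relIndex]

/-- The center of the nontrivial `p`-group `P / P₀` is nontrivial, and its preimage is normal in
`G`, hence equal to `P`. -/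
theorem commutator_le [Finite G] [Fact p.Prime] (h : IsIrreducibleSection p k P P₀ R) :
    ⁅P, P⁆ ≤ P₀ := by
  have := h.normal
  have := h.normal_bot
  let q := QuotientGroup.mk' P₀
  have hq : Function.Surjective q := QuotientGroup.mk'_surjective P₀
  have hmap : (P.map q).Normal := h.normal.map q hq
  have hcomap : (P.map q).comap q = P := by
    rw [Subgroup.comap_map_eq, QuotientGroup.ker_mk', sup_eq_left.2 h.le]
  have hcen : (centerIn (P.map q)).Normal := ConjAct.normal_of_characteristic_of_normal
  have hle : centerIn (P.map q) ≤ P.map q := Subgroup.map_subtype_le _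
  rcases h.eq_or_eq_of_normal (hcen.comap q)
    (fun x hx => by
      rw [Subgroup.mem_comap, show q x = 1 from (QuotientGroup.eq_one_iff x).2 hx]
      exact Subgroup.one_mem _)
    ((Subgroup.comap_mono hle).trans hcomap.le) with h1 | h1
  · exfalso
    have hbot : centerIn (P.map q) = ⊥ := by
      rw [← Subgroup.map_comap_eq_self_of_surjective hq (centerIn (P.map q)), h1,
        Subgroup.map_eq_bot_iff, QuotientGroup.ker_mk']
    have hpg : IsPGroup p (P.map q) := h.isPGroup.map q
    have hnt : Nontrivial (P.map q) := by
      rw [Subgroup.nontrivial_iff_ne_bot]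
      intro hb
      rw [Subgroup.map_eq_bot_iff, QuotientGroup.ker_mk'] at hb
      exact h.ne (le_antisymm h.le hb)
    exact hpg.bot_lt_center.ne'
      ((Subgroup.map_eq_bot_iff_of_injective _ (P.map q).subtype_injective).1 hbot)
  · rw [Subgroup.commutator_le]
    intro x hx y hy
    obtain ⟨z, hz, hzx⟩ : q x ∈ centerIn (P.map q) := by rwa [← Subgroup.mem_comap, h1]
    have hc := congrArg Subtype.val
      (Subgroup.mem_center_iff.1 hz ⟨q y, Subgroup.mem_map_of_mem q hy⟩)
    have hc' : q y * q x = q x * q y := by rw [← hzx]; exact hc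
    rw [← QuotientGroup.eq_one_iff]
    exact (map_commutatorElement q x y).trans (commutatorElement_eq_one_iff_mul_comm.2 hc'.symm)

/-- The elements of `P` with `p`-th power in `P₀` form an invariant subgroup, larger than `P₀` by
Cauchy's theorem. -/
theorem pow_mem [Finite G] [Fact p.Prime] (h : IsIrreducibleSection p k P P₀ R) {x : G}
    (hx : x ∈ P) : x ^ p ∈ P₀ := by
  have := h.normal_bot
  let q := QuotientGroup.mk' P₀
  have hq : ∀ x : G, q x = 1 ↔ x ∈ P₀ := QuotientGroup.eq_one_iff
  let N : Subgroup G :=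
    { carrier := {x | x ∈ P ∧ x ^ p ∈ P₀}
      one_mem' := ⟨P.one_mem, by rw [one_pow]; exact P₀.one_mem⟩
      inv_mem' := fun {x} hx => ⟨P.inv_mem hx.1, by rw [inv_pow]; exact P₀.inv_mem hx.2⟩
      mul_mem' := fun {x y} hx hy => ⟨P.mul_mem hx.1 hy.1, by
        have hc : Commute (q x) (q y) := by
          rw [← commutatorElement_eq_one_iff_commute, ← map_commutatorElement, hq]
          exact h.commutator_le (Subgroup.commutator_mem_commutator hx.1 hy.1)
        rw [← hq, map_pow, map_mul, hc.mul_pow, ← map_pow, ← map_pow, (hq _).2 hx.2,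
          (hq _).2 hy.2, one_mul]⟩ }
  rcases h.irreducible N (fun x hx => ⟨h.le hx, P₀.pow_mem hx p⟩) (fun x hx => hx.1)
    (fun x hx => ⟨h.normal.conj_mem x hx.1 R, by
      rw [conj_pow]; exact h.normal_bot.conj_mem _ hx.2 R⟩) with h1 | h1
  · exfalso
    obtain ⟨⟨_, y, hy, rfl⟩, hord⟩ := exists_prime_orderOf_dvd_card' (G := P.map q) p
      (h.card_map_mk ▸ dvd_pow_self p (by have := h.two_le; omega))
    have hpow : q y ^ p = 1 := by
      have := pow_orderOf_eq_one (⟨q y, y, hy, rfl⟩ : P.map q)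
      rw [hord] at this
      exact congrArg Subtype.val this
    have hyN : y ∈ N := ⟨hy, by rwa [← hq, map_pow]⟩
    have h1y : (⟨q y, y, hy, rfl⟩ : P.map q) = 1 := Subtype.ext ((hq y).2 (h1 ▸ hyN))
    rw [h1y, orderOf_one] at hord
    exact (Fact.out : p.Prime).one_lt.ne hord
  · exact ((h1 ▸ hx : x ∈ N)).2

/-- If `R` acted trivially on `P / P₀`, every subgroup of order `p` would be invariant, contrary to
`2 ≤ k`. -/
theorem exists_commutatorElement_notMem [Finite G] [Fact p.Prime]
    (h : IsIrreducibleSection p k P P₀ R) : ∃ x ∈ P, ⁅R, x⁆ ∉ P₀ := by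
  by_contra! hcon
  have := h.normal_bot
  obtain ⟨x, hx, hx₀⟩ := SetLike.exists_of_lt (lt_of_le_of_ne h.le h.ne)
  have hNP : P₀ ⊔ Subgroup.zpowers x ≤ P := sup_le h.le ((Subgroup.zpowers_le).2 hx)
  rcases h.irreducible (P₀ ⊔ Subgroup.zpowers x) le_sup_left hNP
    (fun y hy => by
      have h1 := Subgroup.mul_mem _
        ((le_sup_left : P₀ ≤ P₀ ⊔ Subgroup.zpowers x) (hcon y (hNP hy))) hy
      rwa [commutatorElement_def, inv_mul_cancel_right] at h1) with h1 | h1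
  · exact hx₀ (h1 ▸ (le_sup_right : _ ≤ P₀ ⊔ Subgroup.zpowers x) (Subgroup.mem_zpowers x))
  · have hcard := h.card_map_mk
    rw [← h1, Subgroup.map_sup, (Subgroup.map_eq_bot_iff _).2 (QuotientGroup.ker_mk' P₀).ge,
      bot_sup_eq, MonoidHom.map_zpowers, Nat.card_zpowers] at hcard
    have hdvd : p ^ k ∣ p := by
      rw [← hcard]
      refine orderOf_dvd_of_pow_eq_one ?_
      rw [← map_pow]
      exact (QuotientGroup.eq_one_iff _).2 (h.pow_mem hx)
    have hpp := (Fact.out : p.Prime).one_lt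
    have hlt : p ^ 1 < p ^ k := Nat.pow_lt_pow_right hpp (by have := h.two_le; omega)
    rw [pow_one] at hlt
    exact absurd (Nat.le_of_dvd (by omega) hdvd) (by omega)

/-- The centralizer `C` of `P₀` is normal and contains `R`, so it contains every `⁅R, x⁆`. Thus `C ∩
P = P₀` would make `R` act trivially on `P / P₀`; hence `P ≤ C`. -/
theorem le_center [Finite G] [Fact p.Prime] (h : IsIrreducibleSection p k P P₀ R) :
    P₀ ≤ Subgroup.center G := by
  have := h.normal
  have := h.normal_bot
  let C := Subgroup.centralizer (P₀ : Set G)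
  have hC : C.Normal := Subgroup.normal_centralizer
  have hzC : Subgroup.zpowers R ≤ C := by
    intro g hg
    rw [Subgroup.mem_centralizer_iff]
    intro z hz
    obtain ⟨m, rfl⟩ := h.le_zpowers hz
    obtain ⟨n, rfl⟩ := hg
    exact ((Commute.refl R).zpow_zpow m n).eq
  rcases h.eq_or_eq_of_normal (Subgroup.normal_inf_normal C P)
    (le_inf (h.le_zpowers.trans hzC) h.le) inf_le_right with h1 | h1
  · obtain ⟨x, hx, hx₀⟩ := h.exists_commutatorElement_notMem
    refine absurd ?_ hx₀
    rw [← h1]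
    refine ⟨?_, h.commutatorElement_mem R hx⟩
    have hR : R ∈ C := hzC (Subgroup.mem_zpowers R)
    rw [commutatorElement_def, mul_assoc, mul_assoc, ← mul_assoc x]
    exact C.mul_mem hR (hC.conj_mem _ (C.inv_mem hR) x)
  · have htop : C = ⊤ := by
      rw [eq_top_iff, ← h.sup_eq_top]
      exact sup_le (inf_eq_right.1 h1) hzC
    intro z hz
    rw [Subgroup.mem_center_iff]
    intro g
    exact (Subgroup.mem_centralizer_iff.1 (htop ▸ Subgroup.mem_top g : g ∈ C) z hz).symm

theorem mem_of_commutatorElement_mem [Finite G] [Fact p.Prime]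
    (h : IsIrreducibleSection p k P P₀ R) {x : G} (hx : x ∈ P) (hR : ⁅R, x⁆ ∈ P₀) : x ∈ P₀ := by
  have hconj := h.normal_bot.conj_mem
  let N : Subgroup G :=
    { carrier := {x | x ∈ P ∧ ⁅R, x⁆ ∈ P₀}
      one_mem' := ⟨P.one_mem, by rw [commutatorElement_one_right]; exact P₀.one_mem⟩
      inv_mem' := fun {x} hx => ⟨P.inv_mem hx.1, by
        have := hconj _ (P₀.inv_mem hx.2) x⁻¹
        convert this using 1
        simp only [commutatorElement_def]; group⟩
      mul_mem' := fun {x y} hx hy => ⟨P.mul_mem hx.1 hy.1, by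
        have := P₀.mul_mem hx.2 (hconj _ hy.2 x)
        convert this using 1
        simp only [commutatorElement_def]; group⟩ }
  rcases h.irreducible N (fun x hx => ⟨h.le hx, h.commutatorElement_mem_bot R hx⟩)
    (fun x hx => hx.1)
    (fun x hx => ⟨h.normal.conj_mem x hx.1 R, by
      have := hconj _ hx.2 R
      convert this using 1
      simp only [commutatorElement_def]; group⟩) with h1 | h1
  · exact h1 ▸ (⟨hx, hR⟩ : x ∈ N)
  · obtain ⟨y, hy, hy₀⟩ := h.exists_commutatorElement_notMem
    exact absurd (h1 ▸ hy : y ∈ N).2 hy₀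

/-- This pulls back `exists_complement_commutators` from `G / P'`. The explicit form of the elements
of `E` serves to compute their `p`-th powers. -/
theorem exists_supplement [Finite G] [Fact p.Prime] (h : IsIrreducibleSection p k P P₀ R) :
    ∃ E : Subgroup G, E ⊔ P₀ = P ∧ E ⊓ P₀ = ⁅P, P⁆ ∧
      ∀ e ∈ E, ∃ y ∈ P, ∃ c ∈ ⁅P, P⁆, e = ⁅R, y⁆ * c := by
  have := h.normal
  have := h.normal_bot
  let q := QuotientGroup.mk' ⁅P, P⁆
  have hq : Function.Surjective q := QuotientGroup.mk'_surjective _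
  have hq1 : ∀ x : G, q x = 1 ↔ x ∈ ⁅P, P⁆ := QuotientGroup.eq_one_iff
  have hqe : ∀ x y : G, q x = q y → ∃ c ∈ ⁅P, P⁆, y = x * c := fun x y hxy =>
    ⟨x⁻¹ * y, QuotientGroup.eq.1 hxy, by group⟩
  have hmap : (P.map q).Normal := h.normal.map q hq
  have hDP : ⁅P, P⁆ ≤ P := h.commutator_le.trans h.le
  have hmem₀ : ∀ x : G, q x ∈ P₀.map q → x ∈ P₀ := by
    rintro x ⟨z, hz, hzx⟩
    obtain ⟨c, hc, rfl⟩ := hqe _ _ hzx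
    exact P₀.mul_mem hz (h.commutator_le hc)
  obtain ⟨T, hT₁, hT₂, hT₃⟩ := exists_complement_commutators (A := P.map q) (A₀ := P₀.map q)
    (by
      rintro _ ⟨x, hx, rfl⟩ _ ⟨y, hy, rfl⟩
      rw [← commutatorElement_eq_one_iff_mul_comm, ← map_commutatorElement, hq1]
      exact Subgroup.commutator_mem_commutator hx hy)
    (Subgroup.map_mono h.le)
    (by
      rintro _ ⟨z, hz, rfl⟩
      rw [Subgroup.mem_center_iff]
      intro g
      obtain ⟨g, rfl⟩ := hq g
      rw [← map_mul, ← map_mul, Subgroup.mem_center_iff.1 (h.le_center hz) g])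
    (q R)
    (by
      rintro _ ⟨x, hx, rfl⟩ hRx
      rw [← map_commutatorElement] at hRx
      exact Subgroup.mem_map_of_mem q (h.mem_of_commutatorElement_mem hx (hmem₀ _ hRx)))
  have hE : ∀ e, q e ∈ T → ∃ y ∈ P, ∃ c ∈ ⁅P, P⁆, e = ⁅R, y⁆ * c := fun e he => by
    obtain ⟨_, ⟨y, hy, rfl⟩, hye⟩ := hT₃ _ he
    rw [← map_commutatorElement] at hye
    exact ⟨y, hy, hqe _ _ hye.symm⟩
  refine ⟨T.comap q, le_antisymm (sup_le ?_ h.le) ?_, le_antisymm ?_ (le_inf ?_ h.commutator_le), hE⟩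
  · intro e he
    obtain ⟨y, hy, c, hc, rfl⟩ := hE e he
    exact P.mul_mem (h.commutatorElement_mem R hy) (hDP hc)
  · intro x hx
    have hxA : q x ∈ P₀.map q ⊔ T := hT₁.symm ▸ Subgroup.mem_map_of_mem q hx
    have : (P₀.map q).Normal := h.normal_bot.map q hq
    obtain ⟨_, ⟨z, hz, rfl⟩, t, ht, hzt⟩ := Subgroup.mem_sup_of_normal_left.1 hxA
    refine Subgroup.mem_sup_of_normal_right.2 ⟨x * z⁻¹, ?_, z, hz, by group⟩
    rw [Subgroup.mem_center_iff.1 (Subgroup.inv_mem _ (h.le_center hz)) x, Subgroup.mem_comap,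
      map_mul, ← hzt, map_inv, inv_mul_cancel_left]
    exact ht
  · rintro x ⟨hxT, hx₀⟩
    have : q x ∈ P₀.map q ⊓ T := ⟨Subgroup.mem_map_of_mem q hx₀, hxT⟩
    rw [hT₂, Subgroup.mem_bot] at this
    exact (hq1 x).1 this
  · intro x hx
    rw [Subgroup.mem_comap, (hq1 x).2 hx]
    exact T.one_mem

end IsIrreducibleSection

/-! ### The structure of `P`. -/

theorem mem_centerIn_iff {G : Type*} [Group G] {P : Subgroup G} {x : G} :
    x ∈ centerIn P ↔ x ∈ P ∧ ∀ y ∈ P, y * x = x * y := by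
  constructor
  · rintro ⟨z, hz, rfl⟩
    exact ⟨z.2, fun y hy => congrArg Subtype.val (Subgroup.mem_center_iff.1 hz ⟨y, hy⟩)⟩
  · rintro ⟨hx, hc⟩
    exact ⟨⟨x, hx⟩, Subgroup.mem_center_iff.2 fun y => Subtype.ext (hc y y.2), rfl⟩

namespace IsIrreducibleSection

variable {G : Type*} [Group G] [Finite G] {p k : ℕ} [Fact p.Prime] {P P₀ E : Subgroup G} {R : G}

/-- Commutators are central, so `⁅x, y⁆ ^ p = ⁅x ^ p, y⁆`, which is trivial because `x ^ p ∈ P₀` is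
central. -/
theorem pow_eq_one_of_mem_commutator (h : IsIrreducibleSection p k P P₀ R) {d : G}
    (hd : d ∈ ⁅P, P⁆) : d ^ p = 1 := by
  have hz : ∀ x y : P, ⁅x, y⁆ ∈ Subgroup.center P := fun x y =>
    Subgroup.mem_center_iff.2 fun g => Subtype.ext (Subgroup.mem_center_iff.1
      (h.le_center (h.commutator_le (Subgroup.commutator_mem_commutator x.2 y.2))) g)
  let K : Subgroup G :=
    { carrier := {z | z ∈ Subgroup.center G ∧ z ^ p = 1}
      one_mem' := ⟨Subgroup.one_mem _, one_pow p⟩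
      inv_mem' := fun {x} hx => ⟨Subgroup.inv_mem _ hx.1, by rw [inv_pow, hx.2, inv_one]⟩
      mul_mem' := fun {x y} hx hy => ⟨Subgroup.mul_mem _ hx.1 hy.1, by
        have hc : Commute x y := Subgroup.mem_center_iff.1 hy.1 x
        rw [hc.mul_pow, hx.2, hy.2, one_mul]⟩ }
  have hK : ⁅P, P⁆ ≤ K := by
    rw [Subgroup.commutator_le]
    intro x hx y hy
    refine ⟨h.le_center (h.commutator_le (Subgroup.commutator_mem_commutator hx hy)), ?_⟩
    have h1 := congrArg Subtype.val
      (commutatorElement_pow_left_of_central hz (⟨x, hx⟩ : P) ⟨y, hy⟩ p)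
    have h2 : ⁅x ^ p, y⁆ = ⁅x, y⁆ ^ p := h1
    rw [← h2, commutatorElement_eq_one_iff_mul_comm]
    exact (Subgroup.mem_center_iff.1 (h.le_center (h.pow_mem hx)) y).symm
  exact (hK hd).2

/-- As a subgroup of `⟨R⟩`, `P₀` is cyclic, so its elements of order dividing `p` form a group of
order at most `p`; it contains the nontrivial `P'`. -/
theorem mem_commutator_iff_and_card (h : IsIrreducibleSection p k P P₀ R) (hne : ⁅P, P⁆ ≠ ⊥) :
    (∀ z, z ∈ ⁅P, P⁆ ↔ z ∈ P₀ ∧ z ^ p = 1) ∧ Nat.card (⁅P, P⁆ : Subgroup G) = p := by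
  let K : Subgroup G :=
    { carrier := {z | z ∈ P₀ ∧ z ^ p = 1}
      one_mem' := ⟨Subgroup.one_mem _, one_pow p⟩
      inv_mem' := fun {x} hx => ⟨Subgroup.inv_mem _ hx.1, by rw [inv_pow, hx.2, inv_one]⟩
      mul_mem' := fun {x y} hx hy => ⟨Subgroup.mul_mem _ hx.1 hy.1, by
        have hc : Commute x y := Subgroup.mem_center_iff.1 (h.le_center hy.1) x
        rw [hc.mul_pow, hx.2, hy.2, one_mul]⟩ }
  have hDK : ⁅P, P⁆ ≤ K := fun d hd => ⟨h.commutator_le hd, h.pow_eq_one_of_mem_commutator hd⟩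
  have hKR : K ≤ Subgroup.zpowers R := fun z hz => h.le_zpowers hz.1
  have hcyc : IsCyclic K :=
    isCyclic_of_injective (Subgroup.inclusion hKR) (Subgroup.inclusion_injective hKR)
  have hKp : Nat.card K ∣ p := by
    rw [← IsCyclic.exponent_eq_card]
    exact Monoid.exponent_dvd_of_forall_pow_eq_one fun z => Subtype.ext z.2.2
  have hD : Nat.card (⁅P, P⁆ : Subgroup G) = p :=
    ((Nat.dvd_prime Fact.out).1 ((Subgroup.card_dvd_of_le hDK).trans hKp)).resolve_left
      fun h1 => hne (Subgroup.card_eq_one.1 h1)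
  have heq : ⁅P, P⁆ = K :=
    Subgroup.eq_of_le_of_card_ge hDK (hD ▸ Nat.le_of_dvd (Fact.out : p.Prime).pos hKp)
  exact ⟨fun z => by rw [heq]; rfl, hD⟩

theorem eq_centerIn (h : IsIrreducibleSection p k P P₀ R) (hne : ⁅P, P⁆ ≠ ⊥) : P₀ = centerIn P := by
  have := h.normal
  have hcen : (centerIn P).Normal := ConjAct.normal_of_characteristic_of_normal
  refine ((h.eq_or_eq_of_normal hcen (fun z hz => mem_centerIn_iff.2 ⟨h.le hz, fun y _ =>
    Subgroup.mem_center_iff.1 (h.le_center hz) y⟩) (Subgroup.map_subtype_le _)).resolve_right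
    fun h1 => hne ?_).symm
  rw [Subgroup.commutator_eq_bot_iff_le_centralizer]
  intro x hx
  rw [Subgroup.mem_centralizer_iff]
  intro y hy
  rw [← h1] at hx
  exact (mem_centerIn_iff.1 hx).2 y hy

theorem even (h : IsIrreducibleSection p k P P₀ R) (hne : ⁅P, P⁆ ≠ ⊥) : Even k := by
  have hcen : Subgroup.center P = P₀.subgroupOf P := by
    rw [h.eq_centerIn hne, centerIn, Subgroup.subgroupOf,
      Subgroup.comap_map_eq_self_of_injective P.subtype_injective]
  have hcomm : (commutator P).map P.subtype = ⁅P, P⁆ := Subgroup.map_subtype_commutator P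
  refine even_of_card_quotient_center (P := P) (p := p) ?_ ?_ ?_ ?_
  · rw [← Subgroup.card_map_of_injective P.subtype_injective, hcomm,
      (h.mem_commutator_iff_and_card hne).2]
  · rw [hcen, Subgroup.subgroupOf, ← Subgroup.map_le_iff_le_comap, hcomm]
    exact h.commutator_le
  · intro x
    rw [hcen, Subgroup.mem_subgroupOf]
    exact h.pow_mem x.2
  · rw [hcen, ← h.relIndex]
    rfl

theorem nonempty_mulEquiv_supplement (h : IsIrreducibleSection p k P P₀ R) (hbot : ⁅P, P⁆ = ⊥)
    (hsup : E ⊔ P₀ = P) (hinf : E ⊓ P₀ = ⁅P, P⁆) :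
    Nonempty (E ≃* Multiplicative (Fin k → ZMod p)) := by
  have := h.normal_bot
  have hEP : E ≤ P := hsup ▸ le_sup_left
  let : CommGroup E :=
    { (inferInstance : Group E) with
      mul_comm := fun x y => Subtype.ext (by
        have hxy := Subgroup.commutator_mem_commutator (hEP x.2) (hEP y.2)
        rw [hbot, Subgroup.mem_bot, commutatorElement_eq_one_iff_mul_comm] at hxy
        exact hxy) }
  refine nonempty_mulEquiv_of_pow_eq_one (A := E) (p := p) (fun x => Subtype.ext ?_) ?_
  · have hx : (x : G) ^ p ∈ E ⊓ P₀ := ⟨E.pow_mem x.2 p, h.pow_mem (hEP x.2)⟩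
    rwa [hinf, hbot, Subgroup.mem_bot] at hx
  · rw [← h.relIndex, ← hsup, Subgroup.relIndex_sup_right, ← Subgroup.inf_relIndex_left, hinf, hbot,
      Subgroup.relIndex_bot_left]

theorem isExtraspecial_supplement (h : IsIrreducibleSection p k P P₀ R) (hne : ⁅P, P⁆ ≠ ⊥)
    (hsup : E ⊔ P₀ = P) (hinf : E ⊓ P₀ = ⁅P, P⁆) : IsExtraspecial p E := by
  have := h.normal_bot
  have hEP : E ≤ P := hsup ▸ le_sup_left
  have hDE : ⁅P, P⁆ ≤ E := hinf ▸ inf_le_left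
  -- Since `P = E P₀` with `P₀` central, an element of `Z(E)` is central in `P`; thus `Z(E) = E ∩ P₀
  -- = P'`.
  have hcommute : ∀ x ∈ E, (∀ y ∈ E, y * x = x * y) → x ∈ P₀ := by
    intro x hx hxE
    rw [h.eq_centerIn hne, mem_centerIn_iff]
    refine ⟨hEP hx, fun y hy => ?_⟩
    obtain ⟨e, he, z, hz, rfl⟩ := Subgroup.mem_sup_of_normal_right.1 (hsup.symm ▸ hy : y ∈ E ⊔ P₀)
    have hzx := Subgroup.mem_center_iff.1 (h.le_center hz) x
    rw [mul_assoc, ← hzx, ← mul_assoc, hxE e he, mul_assoc]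
  have hcen : Subgroup.center E = (⁅P, P⁆ : Subgroup G).subgroupOf E := by
    ext x
    rw [Subgroup.mem_center_iff, Subgroup.mem_subgroupOf, ← hinf]
    constructor
    · intro hx
      exact ⟨x.2, hcommute x x.2 fun y hy => congrArg Subtype.val (hx ⟨y, hy⟩)⟩
    · intro hx y
      exact Subtype.ext (Subgroup.mem_center_iff.1 (h.le_center hx.2) y)
  have hcomm : (commutator E).map E.subtype = ⁅E, E⁆ := Subgroup.map_subtype_commutator E
  refine isExtraspecial_of_commutator_le_center (h.isPGroup.to_le hEP) ?_ ?_ ?_ ?_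
  · rw [hcen, Nat.card_congr (Subgroup.subgroupOfEquivOfLe hDE).toEquiv,
      (h.mem_commutator_iff_and_card hne).2]
  · rw [hcen, Subgroup.subgroupOf, ← Subgroup.map_le_iff_le_comap, hcomm]
    exact Subgroup.commutator_mono hEP hEP
  · intro hbot
    rw [hbot, Subgroup.map_bot] at hcomm
    have hEP₀ : E ≤ P₀ := fun x hx => hcommute x hx fun y hy => by
      rw [← commutatorElement_eq_one_iff_mul_comm, ← Subgroup.mem_bot, hcomm]
      exact Subgroup.commutator_mem_commutator hy hx
    exact h.ne (hsup ▸ (sup_eq_right.2 hEP₀).symm)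
  · intro x
    rw [hcen, Subgroup.mem_subgroupOf, ← hinf]
    exact ⟨E.pow_mem x.2 p, h.pow_mem (hEP x.2)⟩

theorem eq_omegaOne (h : IsIrreducibleSection p k P P₀ R) (hne : ⁅P, P⁆ ≠ ⊥)
    (hsup : E ⊔ P₀ = P) (hinf : E ⊓ P₀ = ⁅P, P⁆)
    (hE : ∀ e ∈ E, ∃ y ∈ P, ∃ c ∈ ⁅P, P⁆, e = ⁅R, y⁆ * c) (hp : 2 < p) : E = omegaOne p P := by
  have := h.normal_bot
  have hEP : E ≤ P := hsup ▸ le_sup_left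
  have hpow : ∀ e ∈ E, e ^ p = 1 := by
    intro e he
    obtain ⟨y, hy, c, hc, rfl⟩ := hE e he
    have hcc : Commute ⁅R, y⁆ c :=
      Subgroup.mem_center_iff.1 (h.le_center (h.commutator_le hc)) _
    have hD : ⁅y⁻¹, R * y * R⁻¹⁆ ∈ ⁅P, P⁆ :=
      Subgroup.commutator_mem_commutator (P.inv_mem hy) (h.normal.conj_mem y hy R)
    -- For odd `p` the exponent of the correction term in `mul_pow_of_central` is a multiple of `p`.
    -- With `⁅R, y⁆ = (R * y * R⁻¹) * y⁻¹` and `y ^ p` central, the `p`-th power of `⁅R, y⁆` is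
    -- trivial.
    have hodd : p * (p - 1) / 2 = p * ((p - 1) / 2) := by
      obtain ⟨m, hm⟩ := (Fact.out : p.Prime).odd_of_ne_two hp.ne'
      exact Nat.mul_div_assoc p (Dvd.intro m (by omega))
    have hRy : R * y ^ p * R⁻¹ = y ^ p := by
      rw [Subgroup.mem_center_iff.1 (h.le_center (h.pow_mem hy)) R, mul_inv_cancel_right]
    rw [hcc.mul_pow, h.pow_eq_one_of_mem_commutator hc, mul_one, commutatorElement_def,
      mul_pow_of_central (h.le_center (h.commutator_le hD)), hodd, pow_mul,
      h.pow_eq_one_of_mem_commutator hD, one_pow, mul_one, conj_pow, hRy, inv_pow, mul_inv_cancel]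
  refine le_antisymm (fun e he => ?_) ?_
  · have : e ∈ {x | x ∈ P ∧ x ^ p = 1} := ⟨hEP he, hpow e he⟩
    exact Subgroup.subset_closure this
  rw [omegaOne, Subgroup.closure_le]
  rintro x ⟨hx, hxp⟩
  obtain ⟨e, he, z, hz, rfl⟩ := Subgroup.mem_sup_of_normal_right.1 (hsup.symm ▸ hx : x ∈ E ⊔ P₀)
  have hc : Commute e z := Subgroup.mem_center_iff.1 (h.le_center hz) e
  rw [hc.mul_pow, hpow e he, one_mul] at hxp
  have hzD : z ∈ ⁅P, P⁆ := ((h.mem_commutator_iff_and_card hne).1 z).2 (And.intro hz hxp)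
  exact E.mul_mem he ((hinf ▸ inf_le_left : ⁅P, P⁆ ≤ E) hzD)

theorem directProduct_or_centralProduct (h : IsIrreducibleSection p k P P₀ R) :
    (∃ T : Subgroup G, IsInternalDirectProduct P P₀ T ∧
      Nonempty (T ≃* Multiplicative (Fin k → ZMod p))) ∨
    (P₀ = centerIn P ∧
      (∃ E : Subgroup G, IsExtraspecial p E ∧ IsCentralProduct P E P₀ ∧
        (2 < p → E = omegaOne p P)) ∧
      Even k) := by
  obtain ⟨E, hsup, hinf, hE⟩ := h.exists_supplement
  have hcomm : ⁅E, P₀⁆ = ⊥ := by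
    rw [Subgroup.commutator_eq_bot_iff_le_centralizer]
    intro x _
    rw [Subgroup.mem_centralizer_iff]
    exact fun z hz => (Subgroup.mem_center_iff.1 (h.le_center hz) x).symm
  by_cases hbot : ⁅P, P⁆ = ⊥
  · exact Or.inl ⟨E, ⟨by rw [sup_comm, hsup], by rw [inf_comm, hinf, hbot],
      by rw [Subgroup.commutator_comm, hcomm]⟩, h.nonempty_mulEquiv_supplement hbot hsup hinf⟩
  · exact Or.inr ⟨h.eq_centerIn hbot, ⟨E, h.isExtraspecial_supplement hbot hsup hinf,
      ⟨hsup, h.eq_centerIn hbot ▸ inf_le_right, hcomm⟩, h.eq_omegaOne hbot hsup hinf hE⟩,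
      h.even hbot⟩

end IsIrreducibleSection

/-! ### Vertex stabilizers of the map and the conclusion. -/

/-- The generator is the automorphism `R` sending an arc `d` at the vertex to `r d`. As `R` commutes
with `r`, `R ^ n` and `r ^ n` agree at `d`; an automorphism fixing the vertex sends `d` to some `r ^
n d`, so by regularity it is `R ^ n`. -/
theorem OrientableMap.exists_stabilizer_eq_zpowers {D : Type*} (M : OrientableMap D)
    (hreg : M.IsOrientablyRegular) (v : M.Vertex) :
    ∃ R : M.aut, MulAction.stabilizer M.aut v = Subgroup.zpowers R := by
  obtain ⟨d⟩ := v
  obtain ⟨R, hR, -⟩ := hreg d (M.r d)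
  have hR' : (R : Equiv.Perm D) d = M.r d := hR
  have hcomm : Commute M.r⁻¹ (R : Equiv.Perm D) :=
    Commute.inv_left (R.2 M.r (by simp))
  have hpow : ∀ n : ℤ, ((R : Equiv.Perm D) ^ n) d = (M.r ^ n) d := fun n => by
    have h1 : ((M.r⁻¹ * R) ^ n) d = d :=
      Equiv.Perm.zpow_apply_eq_self_of_apply_eq_self (by rw [Equiv.Perm.mul_apply, hR']; simp) n
    rw [hcomm.mul_zpow, inv_zpow, Equiv.Perm.mul_apply, Equiv.Perm.inv_eq_iff_eq] at h1
    exact h1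
  have hmk : ∀ g : M.aut, g ∈ MulAction.stabilizer M.aut (M.vertexOf d) ↔
      ∃ n : ℤ, (M.r ^ n) d = (g : Equiv.Perm D) d := fun g => by
    rw [MulAction.mem_stabilizer_iff]
    refine Quotient.eq.trans ?_
    constructor
    · rintro ⟨⟨_, n, rfl⟩, hn⟩
      exact ⟨n, hn⟩
    · rintro ⟨n, hn⟩
      exact ⟨⟨M.r ^ n, n, rfl⟩, hn⟩
  refine ⟨R, Subgroup.ext fun g => (hmk g).trans ?_⟩
  rw [Subgroup.mem_zpowers_iff]
  refine exists_congr fun n => ⟨fun hn => ?_, ?_⟩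
  · refine (hreg d ((g : Equiv.Perm D) d)).unique ?_ rfl
    exact (congrArg (fun f : Equiv.Perm D => f d) (SubgroupClass.coe_zpow R n)).trans
      ((hpow n).trans hn)
  · rintro rfl
    rw [SubgroupClass.coe_zpow, hpow]

theorem proposition7p1 {D : Type*} [Finite D] (M : OrientableMap D) (hreg : M.IsOrientablyRegular)
    (p k : ℕ) (hp : p.Prime) (hk : 2 ≤ k) (hV : Nat.card M.Vertex = p ^ k)
    (hnormal : M.IsNormalMap p) (hprim : MulAction.IsPreprimitive M.aut M.Vertex)
    (v : M.Vertex) (H : Subgroup M.aut) (hH : H = MulAction.stabilizer M.aut v)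
    (P : Sylow p M.aut) (P₀ : Subgroup M.aut) (hP₀ : P₀ = H.normalCore ⊓ (P : Subgroup M.aut)) :
    (∃ T : Subgroup M.aut, IsInternalDirectProduct (P : Subgroup M.aut) P₀ T ∧
      Nonempty (T ≃* Multiplicative (Fin k → ZMod p))) ∨
    (P₀ = centerIn (P : Subgroup M.aut) ∧
      (∃ E : Subgroup M.aut, IsExtraspecial p E ∧
        IsCentralProduct (P : Subgroup M.aut) E P₀ ∧
        (2 < p → E = omegaOne p (P : Subgroup M.aut))) ∧
      Even k) := by

  have := Fact.mk hp
  have hpk : 1 < p ^ k := Nat.one_lt_pow (by omega) hp.one_lt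
  have : Finite M.Vertex := Nat.finite_of_card_ne_zero (by omega)
  have : Nontrivial M.Vertex := Finite.one_lt_card_iff_nontrivial.1 (hV ▸ hpk)
  obtain ⟨R, hR⟩ := M.exists_stabilizer_eq_zpowers hreg v
  have hP : (P : Subgroup M.aut).Normal := by
    obtain ⟨Q, hQ⟩ := hnormal
    have := Sylow.unique_of_normal Q hQ
    rwa [Subsingleton.elim P Q]
  subst hH hP₀
  exact (isIrreducibleSection_of_isCoatom hR
    (MulAction.IsPreprimitive.isCoatom_stabilizer_of_isPreprimitive M.aut v)
    ((MulAction.index_stabilizer_of_transitive M.aut v).trans hV) hk P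
    ).directProduct_or_centralProduct
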